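/- All logarithms are to base $2$, $H(p)=-\sum_k p_k\log p_k$, and an $n\times n$ complex matrix $W$ is called Hadamard if it is unitary and $|W_{ij}|=1/\sqrt n$ for all $i,j$. Setting. A database has $n\ge 1$ configurations $d$ with uniform prior $P(d)=1/n$. For unitary $n\times n$ encodings $E_0,E_1$, one $i\in\{0,1\}$ is chosen with probability $1/2$ and the user receives the state $E_i|d\rangle$. Without knowing $i$, the user performs a projective measurement: either in an orthonormal basis, given by a unitary matrix $M$, with outcome probabilities $P(j\mid d,i)=|(ME_i)_{j,d}|^2$, or, more generally, given by finitely many mutually orthogonal Hermitian projections $\Pi_j$ of arbitrary rank with $\sum_j\Pi_j=I$, with $P(j\mid d,i)=(E_i^\dagger\Pi_jE_i)_{d,d}$. Then $i$ is announced, and the user forms the posterior $P(\cdot\mid j,i)$ by Bayes' theorem. Put $h_{j,i}=H(P(\cdot\mid j,i))$ and $h_j=(h_{j,0}+h_{j,1})/2$. The information gain at outcome $j$, averaged over the two encodings, is $\log n-h_j$; the expected information gain is $\log n-\frac12\sum_{i}\sum_j P(j\mid i)\,h_{j,i}$, where $P(j\mid i)=\frac1n\sum_d P(j\mid d,i)$.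 (a) If $E_1^\dagger E_0$ is Hadamard, then for every such measurement the gain $\log n-h_j$ at every outcome $j$ (with $\Pi_j\ne0$), and hence also the expected information gain, is at most $\frac12\log n$. For every such pair $E_0,E_1$ the bound is attained: for some unitary $M$ the gain at every outcome, and the expected gain, equal $\frac12\log n$. (b) Let $m\ge 0$, let the database consist of two $m$-bit items $d_0,d_1$ (so $n=2^{2m}$), let $A_0,A_1$ be unitary $2^m\times 2^m$ matrices with $A_0^\dagger A_1$ Hadamard (such matrices exist for every $m$), let $P$ be the permutation matrix with $P|d_0d_1\rangle=|d_1d_0\rangle$, and put $E_0=A_0\otimes A_1$, $E_1=(A_1\otimes A_0)P$. Then $E_0,E_1$ are unitary, $E_1^\dagger E_0$ is Hadamard, and for every such measurement the gain at every outcome $j$ (with $\Pi_j\neq 0$), and the expected gain, are at most $m$ bits. The bound is attained: for each of the unitary matrices $M=A_0^\dagger\otimes A_0^\dagger$ and $M=A_1^\dagger\otimes A_1^\dagger$ the gain at every outcome, and the expected gain, equal $m$. -/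

import Mathlib

open scoped Matrix Kronecker

namespace PrivateQuery

noncomputable section

/-- A (complex, normalised) `n × n` Hadamard matrix: a unitary matrix all of whose entries have
absolute value `1 / √n`. -/
def IsHadamard {D : Type*} [Fintype D] [DecidableEq D] (W : Matrix D D ℂ) : Prop :=
  W ∈ Matrix.unitaryGroup D ℂ ∧ ∀ i j, ‖W i j‖ = 1 / √(Fintype.card D : ℝ)

/-- Shannon entropy in bits, `H(p) = - ∑ₖ pₖ log₂ pₖ` (with `0 log₂ 0 = 0`). -/
def entropy {D : Type*} [Fintype D] (p : D → ℝ) : ℝ :=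
  -∑ d, p d * Real.logb 2 (p d)

/-- The uniform prior on the database configurations. -/
def uniformPrior (D : Type*) [Fintype D] : D → ℝ :=
  fun _ => 1 / (Fintype.card D : ℝ)

/-- Unconditional probability of the outcome `j`, `∑_d P(j | d) P(d)`, for a likelihood
`lik j d = P(j | d)`. -/
def outcomeProb {J D : Type*} [Fintype D] (prior : D → ℝ) (lik : J → D → ℝ) (j : J) : ℝ :=
  ∑ d, lik j d * prior d

/-- Posterior distribution of the database after the outcome `j`, by Bayes' theorem. -/
def posterior {J D : Type*} [Fintype D] (prior : D → ℝ) (lik : J → D → ℝ) (j : J) (d : D) : ℝ :=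
  lik j d * prior d / outcomeProb prior lik j

/-- The user's remaining uncertainty about the database after observing the outcome `j`, averaged
over the two equally likely encodings `i`; here `lik i j d = P(j | d, i)`. -/
def remainingEntropy {J D : Type*} [Fintype D] (prior : D → ℝ) (lik : Fin 2 → J → D → ℝ)
    (j : J) : ℝ :=
  (∑ i, entropy (posterior prior (lik i) j)) / 2

/-- Information gain at the outcome `j`, averaged over the two encodings. -/
def gainAt {J D : Type*} [Fintype D] (prior : D → ℝ) (lik : Fin 2 → J → D → ℝ) (j : J) : ℝ :=
  entropy prior - remainingEntropy prior lik j

/-- Expected information gain, averaged over the two equally likely encodings, the database and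
the measurement outcome. -/
def expectedGain {J D : Type*} [Fintype J] [Fintype D] (prior : D → ℝ)
    (lik : Fin 2 → J → D → ℝ) : ℝ :=
  entropy prior -
    (∑ i, ∑ j, outcomeProb prior (lik i) j * entropy (posterior prior (lik i) j)) / 2

/-- `P(j | d, i) = |(M Eᵢ)_{j,d}|²`: the user applies `M` to the state `Eᵢ d` and reads off the
basis label `j`. The matrix `M` does not depend on the encoding `i`. -/
def basisLik {D : Type*} [Fintype D] (M : Matrix D D ℂ) (E : Fin 2 → Matrix D D ℂ) :
    Fin 2 → D → D → ℝ :=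
  fun i j d => ‖(M * E i) j d‖ ^ 2

/-- A projective measurement with outcome set `J`: mutually orthogonal Hermitian projections, of
arbitrary rank, that sum to the identity. -/
structure ProjectiveMeasurement (J D : Type*) [Fintype J] [Fintype D] [DecidableEq D] where
  proj : J → Matrix D D ℂ
  hermitian : ∀ j, (proj j).IsHermitian
  idempotent : ∀ j, proj j * proj j = proj j
  orthogonal : ∀ j k, j ≠ k → proj j * proj k = 0
  complete : ∑ j, proj j = 1

/-- `P(j | d, i) = ⟨Eᵢ d, Πⱼ Eᵢ d⟩` for the projective measurement `(Πⱼ)`. -/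
def ProjectiveMeasurement.lik {J D : Type*} [Fintype J] [Fintype D] [DecidableEq D]
    (Q : ProjectiveMeasurement J D) (E : Fin 2 → Matrix D D ℂ) : Fin 2 → J → D → ℝ :=
  fun i j d => (((E i)ᴴ * Q.proj j * E i) d d).re

/-- The values of an `m`-bit item. -/
abbrev Item (m : ℕ) : Type := Fin m → Bool

/-- The permutation matrix with `P |d₀ d₁⟩ = |d₁ d₀⟩`. -/
def swapMatrix (m : ℕ) : Matrix (Item m × Item m) (Item m × Item m) ℂ :=
  Matrix.of fun r d => if r = d.swap then 1 else 0

/-- The two encodings `E₀ = A₀ ⊗ A₁` and `E₁ = (A₁ ⊗ A₀) P` of a database of two `m`-bit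
items. -/
def tensorEncoding {m : ℕ} (A₀ A₁ : Matrix (Item m) (Item m) ℂ) :
    Fin 2 → Matrix (Item m × Item m) (Item m × Item m) ℂ :=
  ![A₀ ⊗ₖ A₁, (A₁ ⊗ₖ A₀) * swapMatrix m]

end

end PrivateQuery

open PrivateQuery

/-! The bound is the Maassen–Uffink uncertainty relation in disguise. Fix an outcome `j`. The column
of `Πⱼ Eᵢ` at `d` (the scalar `(M Eᵢ)_{j,d}` for a basis measurement) is a vector `x i d`, and `P(j
| d, i) = ‖x i d‖²`. Since `E₀ = E₁ (E₁ᴴ E₀)`, the two families are related by a Hadamard matrix, so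
they have equal total mass; under the uniform prior the two posteriors are these squared norms,
normalised. `IsHadamard.logb_card_le_entropy_add` says that their entropies add up to at least `log
n`, so the average `hⱼ` is at least `(log n) / 2`. Equal masses also make `P(j | i)` independent of
`i`, so the expected gain is a weighted mean of the gains at the outcomes.

The relation comes from the three lines theorem, applied to `F z = ∑ W e d ⟪y e, x d⟫ (‖y e‖ ‖x d‖)
^ z` with `y = W x`: `F 0 = 1`, `|F| ≤ 1` on `re z = 0` by unitarity, and `|F| ≤ 1 / √n` on `re z =
1` by flatness of `W`. Hence the derivative of `F` at `0`, which is minus the sum of the entropies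
up to scale, is at most `log (1 / √n)`.

Equality holds when both posteriors are uniform on sets whose sizes multiply to `n`. -/

namespace PrivateQuery

/-! ### Derivative bound from the three lines theorem -/

section ThreeLines

/-- If an exponential sum `∑ aₖ exp (lₖ z)` with value `1` at `0` is bounded by `1` on the line
`re z = 0` and by `c` on the line `re z = 1`, then its derivative at `0` is at most `log c`. -/
theorem re_sum_mul_le_log_of_norm_expSum_le {ι : Type*} [Fintype ι] (a : ι → ℂ) (l : ι → ℝ)
    {c : ℝ} (hc : 0 < c) (h0 : ∑ k, a k = 1)
    (hl : ∀ z : ℂ, z.re = 0 → ‖∑ k, a k * Complex.exp (z * l k)‖ ≤ 1)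
    (hr : ∀ z : ℂ, z.re = 1 → ‖∑ k, a k * Complex.exp (z * l k)‖ ≤ c) :
    (∑ k, a k * l k).re ≤ Real.log c := by
  set F : ℂ → ℂ := fun z => ∑ k, a k * Complex.exp (z * l k) with hF
  have hdiff : Differentiable ℂ F := by
    intro z; simp only [hF]; fun_prop
  have hbdd : BddAbove ((norm ∘ F) '' Complex.HadamardThreeLines.verticalClosedStrip 0 1) := by
    refine ⟨∑ k, ‖a k‖ * Real.exp |l k|, ?_⟩
    rintro _ ⟨z, hz, rfl⟩
    obtain ⟨hz0, hz1⟩ : 0 ≤ z.re ∧ z.re ≤ 1 := hz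
    refine (norm_sum_le _ _).trans (Finset.sum_le_sum fun k _ => ?_)
    rw [norm_mul, Complex.norm_exp, Complex.re_mul_ofReal]
    gcongr
    calc z.re * l k ≤ z.re * |l k| := by gcongr; exact le_abs_self _
      _ ≤ 1 * |l k| := by gcongr
      _ = |l k| := one_mul _
  have hinterp : ∀ s ∈ Set.Icc (0 : ℝ) 1, (F s).re ≤ c ^ s := by
    intro s hs
    have h := Complex.HadamardThreeLines.norm_le_interp_of_mem_verticalClosedStrip₀₁' F
      (z := (s : ℂ)) (a := 1) (b := c) (by simpa [Complex.HadamardThreeLines.verticalClosedStrip]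
        using hs) hdiff.diffContOnCl hbdd (fun z hz => hl z hz) (fun z hz => hr z hz)
    simp only [Complex.ofReal_re, Real.one_rpow, one_mul] at h
    exact (Complex.re_le_norm _).trans h
  have hFderiv : HasDerivAt F (∑ k, a k * l k) ((0 : ℝ) : ℂ) := by
    have : ∀ k ∈ Finset.univ, HasDerivAt (fun z : ℂ => a k * Complex.exp (z * l k)) (a k * l k)
        ((0 : ℝ) : ℂ) := by
      intro k _
      have := ((hasDerivAt_mul_const (l k : ℂ) (x := ((0 : ℝ) : ℂ))).cexp).const_mul (a k)
      simpa using this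
    exact HasDerivAt.fun_sum this
  -- This difference vanishes at `0` and is nonnegative on `[0, 1]`, so its right derivative at `0`
  -- is nonnegative.
  have hG : HasDerivAt (fun s : ℝ => c ^ s - (F s).re) (Real.log c - (∑ k, a k * l k).re) 0 := by
    have h1 : HasDerivAt (fun s : ℝ => c ^ s) (Real.log c) 0 := by
      simpa using Real.hasStrictDerivAt_const_rpow hc 0 |>.hasDerivAt
    exact h1.sub hFderiv.real_of_complex
  have hzero : c ^ (0 : ℝ) - (F (0 : ℝ)).re = 0 := by simp [hF, h0]
  have hslope := (hasDerivAt_iff_tendsto_slope.mp hG).mono_left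
    (nhdsWithin_mono 0 (show Set.Ioi (0 : ℝ) ⊆ {0}ᶜ from fun s hs => ne_of_gt hs))
  have := ge_of_tendsto hslope (b := 0) (by
    filter_upwards [Ioo_mem_nhdsGT (zero_lt_one' ℝ)] with s hs
    rw [slope_def_field, hzero]
    have := hinterp s ⟨hs.1.le, hs.2.le⟩
    apply div_nonneg <;> linarith [hs.1])
  linarith

end ThreeLines

/-! ### Entropic uncertainty for vector-valued amplitudes -/

section Uncertainty

variable {D V : Type*} [Fintype D] [DecidableEq D] [NormedAddCommGroup V] [InnerProductSpace ℂ V]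

theorem sum_star_smul_sum_smul {W : Matrix D D ℂ} (hW : W ∈ Matrix.unitaryGroup D ℂ) (x : D → V)
    (d : D) : ∑ e, star (W e d) • ∑ d', W e d' • x d' = x d := by
  have h : ∀ d', ∑ e, star (W e d) * W e d' = if d = d' then 1 else 0 := by
    intro d'
    have := congrFun₂ (Matrix.mem_unitaryGroup_iff'.mp hW) d d'
    simpa [Matrix.mul_apply, Matrix.one_apply] using this
  simp_rw [Finset.smul_sum, smul_smul]
  rw [Finset.sum_comm]
  simp_rw [← Finset.sum_smul, h, ite_smul, one_smul, zero_smul]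
  simp

theorem sum_norm_sq_sum_smul {W : Matrix D D ℂ} (hW : W ∈ Matrix.unitaryGroup D ℂ) (x : D → V) :
    ∑ e, ‖∑ d, W e d • x d‖ ^ 2 = ∑ d, ‖x d‖ ^ 2 := by
  have h : ∑ e, inner ℂ (∑ d, W e d • x d) (∑ d, W e d • x d) = ∑ d, inner ℂ (x d) (x d) := by
    calc _ = ∑ e, ∑ d, inner ℂ (x d) (star (W e d) • ∑ d', W e d' • x d') := by
          refine Finset.sum_congr rfl fun e _ => ?_
          rw [sum_inner]
          simp only [inner_smul_left, inner_smul_right, Complex.star_def]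
      _ = ∑ d, inner ℂ (x d) (∑ e, star (W e d) • ∑ d', W e d' • x d') := by
          rw [Finset.sum_comm]
          simp_rw [inner_sum]
      _ = _ := by simp_rw [sum_star_smul_sum_smul hW]
  simp_rw [inner_self_eq_norm_sq_to_K] at h
  exact_mod_cast h

/-- The Maassen–Uffink entropic uncertainty relation for a pair of mutually unbiased bases, in
vector-valued form. -/
theorem uncertainty_log {W : Matrix D D ℂ} (hW : W ∈ Matrix.unitaryGroup D ℂ) {c : ℝ} (hc : 0 < c)
    (hWc : ∀ i j, ‖W i j‖ = c) (x y : D → V) (hxy : ∀ e, y e = ∑ d, W e d • x d)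
    (hx : ∑ d, ‖x d‖ ^ 2 = 1) :
    ∑ e, ‖y e‖ ^ 2 * Real.log ‖y e‖ + ∑ d, ‖x d‖ ^ 2 * Real.log ‖x d‖ ≤ Real.log c := by
  have hy : ∑ e, ‖y e‖ ^ 2 = 1 := by
    simp_rw [hxy]; rw [sum_norm_sq_sum_smul hW, hx]
  have hback : ∀ d, x d = ∑ e, star (W e d) • y e := by
    intro d; simp_rw [hxy]; exact (sum_star_smul_sum_smul hW x d).symm
  have hself : ∀ v : V, inner ℂ v v = ((‖v‖ ^ 2 : ℝ) : ℂ) := by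
    intro v; rw [inner_self_eq_norm_sq_to_K]; simp
  have hyin : ∀ e, ∑ d, W e d * inner ℂ (y e) (x d) = ((‖y e‖ ^ 2 : ℝ) : ℂ) := by
    intro e
    rw [← hself]
    have : inner ℂ (y e) (y e) = inner ℂ (y e) (∑ d, W e d • x d) := by rw [← hxy]
    rw [this, inner_sum]
    simp [inner_smul_right]
  have hxin : ∀ d, ∑ e, W e d * inner ℂ (y e) (x d) = ((‖x d‖ ^ 2 : ℝ) : ℂ) := by
    intro d
    rw [← hself]
    have : inner ℂ (x d) (x d) = inner ℂ (∑ e, star (W e d) • y e) (x d) := by rw [← hback]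
    rw [this, sum_inner]
    simp [inner_smul_left]
  set a : D × D → ℂ := fun p => W p.1 p.2 * inner ℂ (y p.1) (x p.2) with ha
  set l : D × D → ℝ := fun p => Real.log ‖y p.1‖ + Real.log ‖x p.2‖ with hl
  set u : ℂ → D → V := fun z d => Complex.exp (z * Real.log ‖x d‖) • x d with hu
  -- The inner product is conjugate-linear in its first slot; `star z` here makes the pairing
  -- holomorphic in `z`.
  set v : ℂ → D → V := fun z e => Complex.exp (star z * Real.log ‖y e‖) • y e with hv
  have hF : ∀ z : ℂ, ∑ p, a p * Complex.exp (z * l p) =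
      ∑ e, inner ℂ (v z e) (∑ d, W e d • u z d) := by
    intro z
    rw [Fintype.sum_prod_type]
    refine Finset.sum_congr rfl fun e _ => ?_
    rw [inner_sum]
    refine Finset.sum_congr rfl fun d _ => ?_
    simp only [ha, hl, hu, hv, inner_smul_left, inner_smul_right, ← Complex.exp_conj, map_mul,
      Complex.conj_ofReal, Complex.ofReal_add, mul_add, Complex.exp_add, Complex.star_def,
      Complex.conj_conj]
    ring
  have hnorm0 : ∀ (t : ℝ) (z : ℂ), z.re = 0 → ∀ w : V, ‖Complex.exp (z * t) • w‖ = ‖w‖ := by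
    intro t z hz w
    rw [norm_smul, Complex.norm_exp, Complex.re_mul_ofReal, hz]; simp
  have hnorm1 : ∀ (z : ℂ), z.re = 1 → ∀ w : V, ‖Complex.exp (z * Real.log ‖w‖) • w‖ = ‖w‖ ^ 2 := by
    intro z hz w
    rw [norm_smul, Complex.norm_exp, Complex.re_mul_ofReal, hz, one_mul]
    -- Writing the power as `exp (z * log ‖w‖)` fails at `w = 0`, where `log 0 = 0`, but there the
    -- vector itself vanishes.
    rcases eq_or_ne w 0 with rfl | hw
    · simp
    · rw [Real.exp_log (norm_pos_iff.mpr hw), sq]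
  have key := re_sum_mul_le_log_of_norm_expSum_le a l hc ?_ ?_ ?_
  · refine le_trans (le_of_eq ?_) key
    have : ∑ p, a p * (l p : ℂ) =
        ∑ e, ((‖y e‖ ^ 2 * Real.log ‖y e‖ : ℝ) : ℂ) +
          ∑ d, ((‖x d‖ ^ 2 * Real.log ‖x d‖ : ℝ) : ℂ) := by
      simp only [hl, Complex.ofReal_add, mul_add, Finset.sum_add_distrib]
      congr 1
      · rw [Fintype.sum_prod_type]
        refine Finset.sum_congr rfl fun e _ => ?_
        simp only [ha]
        rw [← Finset.sum_mul, hyin]; simp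
      · rw [Fintype.sum_prod_type_right]
        refine Finset.sum_congr rfl fun d _ => ?_
        simp only [ha]
        rw [← Finset.sum_mul, hxin]; simp
    rw [this, ← Complex.ofReal_sum, ← Complex.ofReal_sum, ← Complex.ofReal_add, Complex.ofReal_re]
  · rw [Fintype.sum_prod_type]
    simp_rw [ha, hyin]
    exact_mod_cast hy
  -- Here the exponentials are phases: Cauchy–Schwarz and the unitarity of `W` give the bound.
  · intro z hz
    rw [hF]
    have hz' : (star z).re = 0 := by simpa using hz
    calc _ ≤ ∑ e, ‖y e‖ * ‖∑ d, W e d • u z d‖ := by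
          refine (norm_sum_le _ _).trans (Finset.sum_le_sum fun e _ => ?_)
          refine (norm_inner_le_norm _ _).trans (le_of_eq ?_)
          rw [hv, hnorm0 _ _ hz']
      _ ≤ √(∑ e, ‖y e‖ ^ 2) * √(∑ e, ‖∑ d, W e d • u z d‖ ^ 2) :=
          Real.sum_mul_le_sqrt_mul_sqrt _ _ _
      _ = 1 := by
          rw [sum_norm_sq_sum_smul hW, hy]
          simp_rw [hu, hnorm0 _ _ hz]
          rw [hx]; simp
  -- Here norms become squared norms, and the triangle inequality uses only the size `c` of the
  -- entries.
  · intro z hz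
    rw [hF]
    have hz' : (star z).re = 1 := by simpa using hz
    calc _ ≤ ∑ e, ‖y e‖ ^ 2 * ∑ d, c * ‖x d‖ ^ 2 := by
          refine (norm_sum_le _ _).trans (Finset.sum_le_sum fun e _ => ?_)
          refine (norm_inner_le_norm _ _).trans ?_
          rw [hv, hnorm1 _ hz']
          gcongr
          refine (norm_sum_le _ _).trans (Finset.sum_le_sum fun d _ => ?_)
          rw [norm_smul, hWc, hu, hnorm1 _ hz]
      _ = c := by rw [← Finset.sum_mul, ← Finset.mul_sum, hx, hy]; simp

theorem one_div_sqrt_card_pos (D : Type*) [Fintype D] [Nonempty D] : 0 < 1 / √(Fintype.card D : ℝ) := by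
  have : 0 < Fintype.card D := Fintype.card_pos
  positivity

theorem entropy_norm_sq {D V : Type*} [Fintype D] [NormedAddCommGroup V] (x : D → V) :
    entropy (fun d => ‖x d‖ ^ 2) = -(2 / Real.log 2) * ∑ d, ‖x d‖ ^ 2 * Real.log ‖x d‖ := by
  rw [entropy, neg_mul, Finset.mul_sum]
  congr 1
  refine Finset.sum_congr rfl fun d _ => ?_
  rw [Real.logb, Real.log_pow]
  push_cast
  ring

/-- Entropic uncertainty relation in bits. -/
theorem IsHadamard.logb_card_le_entropy_add [Nonempty D] {W : Matrix D D ℂ} (hW : IsHadamard W)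
    (x y : D → V) (hxy : ∀ e, y e = ∑ d, W e d • x d) (hx : ∑ d, ‖x d‖ ^ 2 = 1) :
    Real.logb 2 (Fintype.card D) ≤
      entropy (fun d => ‖x d‖ ^ 2) + entropy (fun e => ‖y e‖ ^ 2) := by
  have h := uncertainty_log hW.1 (one_div_sqrt_card_pos D) hW.2 x y hxy hx
  have hlog : Real.log (1 / √(Fintype.card D : ℝ)) = -(Real.log (Fintype.card D) / 2) := by
    rw [one_div, Real.log_inv, Real.log_sqrt (by positivity)]
  rw [hlog] at h
  have h2 : 0 < Real.log 2 := Real.log_pos one_lt_two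
  rw [entropy_norm_sq, entropy_norm_sq, Real.logb, ← sub_nonneg]
  have : -(2 / Real.log 2) * ∑ d, ‖x d‖ ^ 2 * Real.log ‖x d‖ +
      -(2 / Real.log 2) * ∑ e, ‖y e‖ ^ 2 * Real.log ‖y e‖ -
        Real.log (Fintype.card D) / Real.log 2 =
      2 / Real.log 2 * (-(Real.log (Fintype.card D) / 2) -
        (∑ e, ‖y e‖ ^ 2 * Real.log ‖y e‖ + ∑ d, ‖x d‖ ^ 2 * Real.log ‖x d‖)) := by
    field_simp; ring
  rw [this]
  exact mul_nonneg (by positivity) (by linarith)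

end Uncertainty

/-! ### Posteriors and gains under the uniform prior -/

section Bayes

variable {J D : Type*} [Fintype D]

theorem outcomeProb_uniformPrior (lik : J → D → ℝ) (j : J) :
    outcomeProb (uniformPrior D) lik j = (∑ d, lik j d) / Fintype.card D := by
  simp [outcomeProb, uniformPrior, ← Finset.sum_mul, div_eq_mul_inv]

theorem posterior_uniformPrior [Nonempty D] (lik : J → D → ℝ) (j : J) (d : D) :
    posterior (uniformPrior D) lik j d = lik j d / ∑ d', lik j d' := by
  have : (Fintype.card D : ℝ) ≠ 0 := by exact_mod_cast Fintype.card_ne_zero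
  rw [posterior, outcomeProb_uniformPrior, uniformPrior, mul_one_div, div_div_div_cancel_right₀ this]

theorem entropy_uniform_on (S : Finset D) (hS : S.Nonempty) [DecidableEq D] :
    entropy (fun d => if d ∈ S then (S.card : ℝ)⁻¹ else 0) = Real.logb 2 S.card := by
  have : (S.card : ℝ) ≠ 0 := by exact_mod_cast hS.card_ne_zero
  have h : ∀ d, (if d ∈ S then (S.card : ℝ)⁻¹ else 0) *
      Real.logb 2 (if d ∈ S then (S.card : ℝ)⁻¹ else 0) =
      if d ∈ S then -((S.card : ℝ)⁻¹ * Real.logb 2 S.card) else 0 := by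
    intro d; split_ifs <;> simp
  simp_rw [entropy, h]
  simp [Finset.sum_ite_mem, this]

theorem entropy_uniformPrior [Nonempty D] :
    entropy (uniformPrior D) = Real.logb 2 (Fintype.card D) := by
  classical
  have := entropy_uniform_on (Finset.univ : Finset D) Finset.univ_nonempty
  have h : uniformPrior D = fun _ => (Fintype.card D : ℝ)⁻¹ := by ext; simp [uniformPrior]
  rw [h]
  simpa using this

/-- If the outcome probabilities do not depend on the encoding, the expected gain is the average of
the gains at the outcomes. -/
theorem expectedGain_eq_sum [Fintype J] (prior : D → ℝ) (lik : Fin 2 → J → D → ℝ) (q : J → ℝ)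
    (hq : ∀ i j, outcomeProb prior (lik i) j = q j) (hsum : ∑ j, q j = 1) :
    expectedGain prior lik = ∑ j, q j * gainAt prior lik j := by
  simp only [expectedGain, gainAt, remainingEntropy, hq, mul_sub, Finset.sum_sub_distrib,
    ← Finset.sum_mul, hsum, one_mul, Fin.sum_univ_two]
  congr 1
  rw [← Finset.sum_add_distrib, Finset.sum_div]
  exact Finset.sum_congr rfl fun j _ => by ring

theorem sum_outcomeProb_uniformPrior [Nonempty D] [Fintype J] (lik : J → D → ℝ)
    (h : ∀ d, ∑ j, lik j d = 1) : ∑ j, outcomeProb (uniformPrior D) lik j = 1 := by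
  have : (Fintype.card D : ℝ) ≠ 0 := by exact_mod_cast Fintype.card_ne_zero
  simp_rw [outcomeProb_uniformPrior]
  rw [← Finset.sum_div, Finset.sum_comm]
  simp [h, this]

end Bayes

/-! ### Upper bound on the gain -/

section UpperBound

variable {J D V : Type*} [Fintype D] [DecidableEq D] [Nonempty D] [NormedAddCommGroup V]
  [InnerProductSpace ℂ V]

theorem gainAt_le_half_logb_card {W : Matrix D D ℂ} (hW : IsHadamard W) (lik : Fin 2 → J → D → ℝ)
    (j : J) (x : Fin 2 → D → V) (hlik : ∀ i d, lik i j d = ‖x i d‖ ^ 2)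
    (hx : ∀ e, x 0 e = ∑ d, W e d • x 1 d) (hne : x 1 ≠ 0) :
    gainAt (uniformPrior D) lik j ≤ 1 / 2 * Real.logb 2 (Fintype.card D) := by
  set T := ∑ d, ‖x 1 d‖ ^ 2 with hT
  have hT0 : ∑ d, ‖x 0 d‖ ^ 2 = T := by
    simp_rw [hx]; rw [sum_norm_sq_sum_smul hW.1]
  have hTpos : 0 < T := by
    obtain ⟨d, hd⟩ := Function.ne_iff.mp hne
    exact Finset.sum_pos' (fun _ _ => by positivity)
      ⟨d, Finset.mem_univ d, pow_pos (norm_pos_iff.mpr hd) 2⟩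
  have hsum : ∀ i, ∑ d, ‖x i d‖ ^ 2 = T := by
    intro i; fin_cases i
    · exact hT0
    · rfl
  set r : ℂ := (((√T)⁻¹ : ℝ) : ℂ) with hr
  have hnorm : ∀ i d, ‖r • x i d‖ ^ 2 = ‖x i d‖ ^ 2 / T := by
    intro i d
    rw [norm_smul, mul_pow, hr, Complex.norm_real, norm_inv, inv_pow, Real.norm_eq_abs, sq_abs,
      Real.sq_sqrt hTpos.le]
    ring
  have hpost : ∀ i, posterior (uniformPrior D) (lik i) j = fun d => ‖r • x i d‖ ^ 2 := by
    intro i; ext d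
    rw [posterior_uniformPrior, hnorm]
    simp_rw [hlik, hsum]
  have key := hW.logb_card_le_entropy_add (fun d => r • x 1 d) (fun e => r • x 0 e)
    (by intro e; simp only [hx, Finset.smul_sum, smul_comm r])
    (by simp_rw [hnorm]; rw [← Finset.sum_div, ← hT, div_self hTpos.ne'])
  rw [gainAt, remainingEntropy, entropy_uniformPrior, Fin.sum_univ_two, hpost, hpost]
  linarith

/-- Leaving `V` general serves both kinds of measurement: `V = ℂ` for a basis, a Euclidean space for
projections of arbitrary rank. -/
theorem gain_le_half_logb_card [Fintype J] {W : Matrix D D ℂ} (hW : IsHadamard W)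
    (lik : Fin 2 → J → D → ℝ) (x : Fin 2 → J → D → V) (hlik : ∀ i j d, lik i j d = ‖x i j d‖ ^ 2)
    (hx : ∀ j e, x 0 j e = ∑ d, W e d • x 1 j d) (hsum : ∀ d, ∑ j, lik 1 j d = 1) :
    (∀ j, x 1 j ≠ 0 →
      gainAt (uniformPrior D) lik j ≤ 1 / 2 * Real.logb 2 (Fintype.card D)) ∧
    expectedGain (uniformPrior D) lik ≤ 1 / 2 * Real.logb 2 (Fintype.card D) := by
  have hgain : ∀ j, x 1 j ≠ 0 →
      gainAt (uniformPrior D) lik j ≤ 1 / 2 * Real.logb 2 (Fintype.card D) := fun j hj =>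
    gainAt_le_half_logb_card hW lik j (fun i => x i j) (fun i d => hlik i j d) (hx j) hj
  refine ⟨hgain, ?_⟩
  set q := outcomeProb (uniformPrior D) (lik 1) with hq
  have hq1 : ∑ j, q j = 1 := sum_outcomeProb_uniformPrior _ hsum
  have hq' : ∀ i j, outcomeProb (uniformPrior D) (lik i) j = q j := by
    intro i j
    fin_cases i
    · simp only [Fin.zero_eta, hq, outcomeProb_uniformPrior, hlik, hx]
      rw [sum_norm_sq_sum_smul hW.1]
    · rfl
  rw [expectedGain_eq_sum _ _ q hq' hq1]
  calc _ ≤ ∑ j, q j * (1 / 2 * Real.logb 2 (Fintype.card D)) := by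
        refine Finset.sum_le_sum fun j _ => ?_
        -- The gain bound is unavailable at a null outcome, but such an outcome has weight zero.
        by_cases hj : x 1 j = 0
        · have : q j = 0 := by simp [hq, outcomeProb_uniformPrior, hlik, hj]
          simp [this]
        · refine mul_le_mul_of_nonneg_left (hgain j hj) ?_
          simp only [hq, outcomeProb_uniformPrior, hlik]
          positivity
    _ = _ := by rw [← Finset.sum_mul, hq1, one_mul]

end UpperBound

/-! ### A criterion for equality -/

section Attained

variable {D : Type*} [Fintype D] [DecidableEq D] [Nonempty D]

/-- Each posterior is uniform on `S i j`, so the two entropies are logarithms of cardinalities and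
sum to `log n`. -/
theorem gain_eq_half_logb_card (lik : Fin 2 → D → D → ℝ) (S : Fin 2 → D → Finset D)
    (hlik : ∀ i j d, lik i j d = if d ∈ S i j then ((S i j).card : ℝ)⁻¹ else 0)
    (hS : ∀ j, (S 0 j).card * (S 1 j).card = Fintype.card D) :
    (∀ j, gainAt (uniformPrior D) lik j = 1 / 2 * Real.logb 2 (Fintype.card D)) ∧
    expectedGain (uniformPrior D) lik = 1 / 2 * Real.logb 2 (Fintype.card D) := by
  have hcard : (Fintype.card D : ℝ) ≠ 0 := by exact_mod_cast Fintype.card_ne_zero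
  have hpos : ∀ i j, (S i j).card ≠ 0 := by
    intro i j h
    have := hS j
    have hD : Fintype.card D ≠ 0 := Fintype.card_ne_zero
    rw [← this] at hD
    fin_cases i
    · exact hD (by rw [show (S 0 j).card = 0 from h, zero_mul])
    · exact hD (by rw [show (S 1 j).card = 0 from h, mul_zero])
  have hsum : ∀ i j, ∑ d, lik i j d = 1 := by
    intro i j
    simp [hlik, Finset.sum_ite_mem, hpos i j]
  have hpost : ∀ i j, entropy (posterior (uniformPrior D) (lik i) j) =
      Real.logb 2 (S i j).card := by
    intro i j
    rw [← entropy_uniform_on _ (Finset.card_ne_zero.mp (hpos i j))]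
    congr 1; ext d
    rw [posterior_uniformPrior, hsum, hlik, div_one]
  have hgain : ∀ j, gainAt (uniformPrior D) lik j = 1 / 2 * Real.logb 2 (Fintype.card D) := by
    intro j
    rw [gainAt, remainingEntropy, entropy_uniformPrior, Fin.sum_univ_two, hpost, hpost,
      ← Real.logb_mul (by exact_mod_cast hpos 0 j) (by exact_mod_cast hpos 1 j)]
    rw [← hS j]; push_cast; ring
  refine ⟨hgain, ?_⟩
  rw [expectedGain_eq_sum _ _ (fun _ => 1 / (Fintype.card D : ℝ))
    (fun i j => by rw [outcomeProb_uniformPrior, hsum]) (by simp [hcard])]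
  simp_rw [hgain]
  simp [hcard]

end Attained

/-! ### Basis and projective measurements -/

section Measurements

variable {D : Type*} [Fintype D] [DecidableEq D]

theorem IsHadamard.transpose {W : Matrix D D ℂ} (hW : IsHadamard W) : IsHadamard Wᵀ := by
  refine ⟨?_, fun i j => hW.2 j i⟩
  rw [Matrix.mem_unitaryGroup_iff]
  have h := Matrix.mem_unitaryGroup_iff'.mp hW.1
  rw [Matrix.star_eq_conjTranspose] at h ⊢
  have hc : Wᵀᴴ = Wᴴᵀ := rfl
  rw [hc, ← Matrix.transpose_mul, h, Matrix.transpose_one]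

theorem norm_one_apply_sq {D : Type*} [DecidableEq D] (i j : D) :
    ‖(1 : Matrix D D ℂ) i j‖ ^ 2 = if j = i then 1 else 0 := by
  by_cases h : i = j <;> simp [Matrix.one_apply, h, Ne.symm]

theorem sum_norm_sq_col_of_mem_unitaryGroup {U : Matrix D D ℂ} (hU : U ∈ Matrix.unitaryGroup D ℂ)
    (d : D) : ∑ j, ‖U j d‖ ^ 2 = 1 := by
  have h := congrFun₂ (Matrix.mem_unitaryGroup_iff'.mp hU) d d
  simp only [Matrix.star_eq_conjTranspose, Matrix.mul_apply, Matrix.conjTranspose_apply,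
    Complex.star_def, Complex.conj_mul', Matrix.one_apply_eq] at h
  exact_mod_cast h

/-- The coefficients come from a column of `E₁ᴴ E₀`; reading them as a row, as the uncertainty
relation requires, produces the transpose. -/
theorem mul_encoding_apply (X : Matrix D D ℂ) {E : Fin 2 → Matrix D D ℂ}
    (hE : ∀ i, E i ∈ Matrix.unitaryGroup D ℂ) (j e : D) :
    (X * E 0) j e = ∑ d, ((E 1)ᴴ * E 0)ᵀ e d * (X * E 1) j d := by
  have h : X * E 0 = X * E 1 * ((E 1)ᴴ * E 0) := by
    have h1 : E 1 * (E 1)ᴴ = 1 := Matrix.mem_unitaryGroup_iff.mp (hE 1)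
    rw [Matrix.mul_assoc, ← Matrix.mul_assoc (E 1), h1, Matrix.one_mul]
  rw [h, Matrix.mul_apply]
  exact Finset.sum_congr rfl fun d _ => by rw [Matrix.transpose_apply, mul_comm]

theorem basisLik_gain_le [Nonempty D] {E : Fin 2 → Matrix D D ℂ} (hE : ∀ i, E i ∈ Matrix.unitaryGroup D ℂ)
    (hH : IsHadamard ((E 1)ᴴ * E 0)) {M : Matrix D D ℂ} (hM : M ∈ Matrix.unitaryGroup D ℂ) :
    (∀ j, gainAt (uniformPrior D) (basisLik M E) j ≤ 1 / 2 * Real.logb 2 (Fintype.card D)) ∧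
    expectedGain (uniformPrior D) (basisLik M E) ≤ 1 / 2 * Real.logb 2 (Fintype.card D) := by
  have hU : ∀ i, M * E i ∈ Matrix.unitaryGroup D ℂ := fun i => mul_mem hM (hE i)
  obtain ⟨h1, h2⟩ := gain_le_half_logb_card hH.transpose (basisLik M E)
    (fun i j d => (M * E i) j d) (fun _ _ _ => rfl)
    (fun j e => by simpa using mul_encoding_apply M hE j e)
    (sum_norm_sq_col_of_mem_unitaryGroup (hU 1))
  refine ⟨fun j => h1 j fun h0 => ?_, h2⟩
  have h := congrFun₂ (Matrix.mem_unitaryGroup_iff.mp (hU 1)) j j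
  have h0' : ∀ d, (M * E 1) j d = 0 := fun d => congrFun h0 d
  rw [Matrix.mul_apply] at h
  simp [h0'] at h

theorem ProjectiveMeasurement.lik_eq_norm_sq {J : Type*} [Fintype J] (Q : ProjectiveMeasurement J D)
    (E : Fin 2 → Matrix D D ℂ) (i : Fin 2) (j : J) (d : D) :
    Q.lik E i j d = ‖WithLp.toLp 2 fun k => (Q.proj j * E i) k d‖ ^ 2 := by
  have h : (E i)ᴴ * Q.proj j * E i = (Q.proj j * E i)ᴴ * (Q.proj j * E i) := by
    rw [Matrix.conjTranspose_mul, (Q.hermitian j).eq, Matrix.mul_assoc, Matrix.mul_assoc,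
      ← Matrix.mul_assoc (Q.proj j), Q.idempotent]
  rw [ProjectiveMeasurement.lik, h, EuclideanSpace.norm_sq_eq, Matrix.mul_apply, Complex.re_sum]
  refine Finset.sum_congr rfl fun k _ => ?_
  rw [Matrix.conjTranspose_apply, Complex.star_def, Complex.conj_mul', ← Complex.ofReal_pow,
    Complex.ofReal_re]

theorem ProjectiveMeasurement.sum_lik {J : Type*} [Fintype J] (Q : ProjectiveMeasurement J D)
    {E : Fin 2 → Matrix D D ℂ} (hE : ∀ i, E i ∈ Matrix.unitaryGroup D ℂ) (i : Fin 2) (d : D) :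
    ∑ j, Q.lik E i j d = 1 := by
  have h : ∑ j, (E i)ᴴ * Q.proj j * E i = 1 := by
    rw [← Finset.sum_mul, ← Finset.mul_sum, Q.complete, Matrix.mul_one]
    exact Matrix.mem_unitaryGroup_iff'.mp (hE i)
  simp only [ProjectiveMeasurement.lik]
  rw [← Complex.re_sum, ← Matrix.sum_apply, h]
  simp

theorem ProjectiveMeasurement.gain_le [Nonempty D] {J : Type*} [Fintype J] (Q : ProjectiveMeasurement J D)
    {E : Fin 2 → Matrix D D ℂ} (hE : ∀ i, E i ∈ Matrix.unitaryGroup D ℂ)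
    (hH : IsHadamard ((E 1)ᴴ * E 0)) :
    (∀ j, Q.proj j ≠ 0 →
      gainAt (uniformPrior D) (Q.lik E) j ≤ 1 / 2 * Real.logb 2 (Fintype.card D)) ∧
    expectedGain (uniformPrior D) (Q.lik E) ≤ 1 / 2 * Real.logb 2 (Fintype.card D) := by
  obtain ⟨h1, h2⟩ := gain_le_half_logb_card hH.transpose (Q.lik E)
    (fun i j d => WithLp.toLp 2 fun k => (Q.proj j * E i) k d)
    (Q.lik_eq_norm_sq E)
    (fun j e => by
      ext k
      simpa using mul_encoding_apply (Q.proj j) hE k e)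
    (Q.sum_lik hE 1)
  refine ⟨fun j hj => h1 j fun h0 => hj ?_, h2⟩
  have h0' : Q.proj j * E 1 = 0 := by
    ext k d
    exact congrArg (fun v : EuclideanSpace ℂ D => v k) (congrFun h0 d)
  have hE1 : E 1 * (E 1)ᴴ = 1 := Matrix.mem_unitaryGroup_iff.mp (hE 1)
  rw [← Matrix.mul_one (Q.proj j), ← hE1, ← Matrix.mul_assoc, h0', Matrix.zero_mul]

theorem IsHadamard.norm_sq {W : Matrix D D ℂ} (hW : IsHadamard W) (i j : D) :
    ‖W i j‖ ^ 2 = (Fintype.card D : ℝ)⁻¹ := by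
  rw [hW.2, div_pow, Real.sq_sqrt (by positivity), one_pow, one_div]

theorem conjTranspose_mem_unitaryGroup {U : Matrix D D ℂ} (hU : U ∈ Matrix.unitaryGroup D ℂ) :
    Uᴴ ∈ Matrix.unitaryGroup D ℂ :=
  Unitary.star_mem hU

theorem IsHadamard.conjTranspose {W : Matrix D D ℂ} (hW : IsHadamard W) : IsHadamard Wᴴ :=
  ⟨conjTranspose_mem_unitaryGroup hW.1, fun i j => by
    rw [Matrix.conjTranspose_apply, norm_star, hW.2]⟩

theorem exists_basisLik_gain_eq [Nonempty D] {E : Fin 2 → Matrix D D ℂ}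
    (hE : ∀ i, E i ∈ Matrix.unitaryGroup D ℂ) (hH : IsHadamard ((E 1)ᴴ * E 0)) :
    ∃ M ∈ Matrix.unitaryGroup D ℂ,
      (∀ j, gainAt (uniformPrior D) (basisLik M E) j = 1 / 2 * Real.logb 2 (Fintype.card D)) ∧
      expectedGain (uniformPrior D) (basisLik M E) = 1 / 2 * Real.logb 2 (Fintype.card D) := by
  -- Measuring in the basis of `E₀` determines `d` when `i = 0` and says nothing when `i = 1`.
  refine ⟨(E 0)ᴴ, conjTranspose_mem_unitaryGroup (hE 0),
    gain_eq_half_logb_card _ ![fun j => {j}, fun _ => Finset.univ] ?_ (by simp)⟩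
  have h0 : (E 0)ᴴ * E 0 = 1 := Matrix.mem_unitaryGroup_iff'.mp (hE 0)
  have h1 : IsHadamard ((E 0)ᴴ * E 1) := by simpa using hH.conjTranspose
  intro i j d
  fin_cases i
  · simp [basisLik, h0, norm_one_apply_sq]
  · simp [basisLik, h1.norm_sq]

end Measurements

/-! ### Two `m`-bit items -/

section TwoItems

theorem isHadamard_kronecker {D D' : Type*} [Fintype D] [DecidableEq D] [Fintype D']
    [DecidableEq D'] {W : Matrix D D ℂ} {W' : Matrix D' D' ℂ} (hW : IsHadamard W)
    (hW' : IsHadamard W') : IsHadamard (W ⊗ₖ W') := by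
  refine ⟨Matrix.kronecker_mem_unitary hW.1 hW'.1, fun i j => ?_⟩
  rw [Matrix.kroneckerMap_apply, norm_mul, hW.2, hW'.2, Fintype.card_prod, Nat.cast_mul,
    Real.sqrt_mul (by positivity), div_mul_div_comm, one_mul]

theorem mul_swapMatrix_apply {m : ℕ} (X : Matrix (Item m × Item m) (Item m × Item m) ℂ)
    (r d : Item m × Item m) : (X * swapMatrix m) r d = X r d.swap := by
  simp [Matrix.mul_apply, swapMatrix]

theorem conjTranspose_swapMatrix_mul_apply {m : ℕ}
    (X : Matrix (Item m × Item m) (Item m × Item m) ℂ) (r d : Item m × Item m) :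
    ((swapMatrix m)ᴴ * X) r d = X r.swap d := by
  simp [Matrix.mul_apply, swapMatrix]

theorem swapMatrix_mem_unitaryGroup (m : ℕ) :
    swapMatrix m ∈ Matrix.unitaryGroup (Item m × Item m) ℂ := by
  rw [Matrix.mem_unitaryGroup_iff', Matrix.star_eq_conjTranspose]
  ext r d
  rw [conjTranspose_swapMatrix_mul_apply]
  simp [swapMatrix, Matrix.one_apply]

theorem card_item (m : ℕ) : Fintype.card (Item m) = 2 ^ m := by simp

theorem card_item_prod (m : ℕ) : Fintype.card (Item m × Item m) = 2 ^ (2 * m) := by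
  rw [Fintype.card_prod, card_item, ← pow_add, two_mul]

theorem half_logb_card_item_prod (m : ℕ) :
    1 / 2 * Real.logb 2 (Fintype.card (Item m × Item m)) = m := by
  rw [card_item_prod, Nat.cast_pow, Nat.cast_ofNat, ← Real.rpow_natCast,
    Real.logb_rpow two_pos (by norm_num)]
  push_cast; ring

variable {m : ℕ} {A₀ A₁ : Matrix (Item m) (Item m) ℂ}

theorem tensorEncoding_mem_unitaryGroup (h₀ : A₀ ∈ Matrix.unitaryGroup (Item m) ℂ)
    (h₁ : A₁ ∈ Matrix.unitaryGroup (Item m) ℂ) (i : Fin 2) :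
    tensorEncoding A₀ A₁ i ∈ Matrix.unitaryGroup (Item m × Item m) ℂ := by
  fin_cases i
  · exact Matrix.kronecker_mem_unitary h₀ h₁
  · exact mul_mem (Matrix.kronecker_mem_unitary h₁ h₀) (swapMatrix_mem_unitaryGroup m)

/-- The product is `Pᴴ ((A₁ᴴ A₀) ⊗ (A₀ᴴ A₁))`, and permuting the rows of a Hadamard matrix keeps it
Hadamard. -/
theorem isHadamard_tensorEncoding (h₀ : A₀ ∈ Matrix.unitaryGroup (Item m) ℂ)
    (h₁ : A₁ ∈ Matrix.unitaryGroup (Item m) ℂ) (hA : IsHadamard (A₀ᴴ * A₁)) :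
    IsHadamard ((tensorEncoding A₀ A₁ 1)ᴴ * tensorEncoding A₀ A₁ 0) := by
  refine ⟨mul_mem (conjTranspose_mem_unitaryGroup (tensorEncoding_mem_unitaryGroup h₀ h₁ 1))
    (tensorEncoding_mem_unitaryGroup h₀ h₁ 0), fun i j => ?_⟩
  have hA' : IsHadamard (A₁ᴴ * A₀) := by simpa using hA.conjTranspose
  have h : (tensorEncoding A₀ A₁ 1)ᴴ * tensorEncoding A₀ A₁ 0 =
      (swapMatrix m)ᴴ * ((A₁ᴴ * A₀) ⊗ₖ (A₀ᴴ * A₁)) := by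
    simp [tensorEncoding, Matrix.conjTranspose_mul, Matrix.conjTranspose_kronecker,
      Matrix.mul_kronecker_mul, Matrix.mul_assoc]
  rw [h, conjTranspose_swapMatrix_mul_apply]
  exact (isHadamard_kronecker hA' hA).2 _ _

theorem basisLik_tensorEncoding_zero (A : Matrix (Item m) (Item m) ℂ) (j d : Item m × Item m) :
    basisLik (Aᴴ ⊗ₖ Aᴴ) (tensorEncoding A₀ A₁) 0 j d =
      ‖(Aᴴ * A₀) j.1 d.1‖ ^ 2 * ‖(Aᴴ * A₁) j.2 d.2‖ ^ 2 := by
  simp [basisLik, tensorEncoding, ← Matrix.mul_kronecker_mul, mul_pow]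

theorem basisLik_tensorEncoding_one (A : Matrix (Item m) (Item m) ℂ) (j d : Item m × Item m) :
    basisLik (Aᴴ ⊗ₖ Aᴴ) (tensorEncoding A₀ A₁) 1 j d =
      ‖(Aᴴ * A₁) j.1 d.2‖ ^ 2 * ‖(Aᴴ * A₀) j.2 d.1‖ ^ 2 := by
  simp [basisLik, tensorEncoding, ← Matrix.mul_assoc, mul_swapMatrix_apply,
    ← Matrix.mul_kronecker_mul, mul_pow]

theorem tensorEncoding_gain_eq_left (h₀ : A₀ ∈ Matrix.unitaryGroup (Item m) ℂ)
    (hA : IsHadamard (A₀ᴴ * A₁)) :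
    (∀ j, gainAt (uniformPrior (Item m × Item m))
      (basisLik (A₀ᴴ ⊗ₖ A₀ᴴ) (tensorEncoding A₀ A₁)) j = m) ∧
    expectedGain (uniformPrior (Item m × Item m))
      (basisLik (A₀ᴴ ⊗ₖ A₀ᴴ) (tensorEncoding A₀ A₁)) = m := by
  have h : A₀ᴴ * A₀ = 1 := Matrix.mem_unitaryGroup_iff'.mp h₀
  rw [← half_logb_card_item_prod]
  -- The item `d₀` is read off exactly, in the first register for `i = 0` and in the second for `i =
  -- 1`; `d₁` stays uniform.
  refine gain_eq_half_logb_card _ ![fun j => {j.1} ×ˢ Finset.univ, fun j => {j.2} ×ˢ Finset.univ]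
    (fun i j d => ?_) (by simp)
  fin_cases i
  · refine (basisLik_tensorEncoding_zero _ _ _).trans ?_
    rw [h, hA.norm_sq, norm_one_apply_sq]
    by_cases hd : d.1 = j.1 <;> simp [hd, Finset.mem_product, -Finset.singleton_product,
      -Finset.product_singleton]
  · refine (basisLik_tensorEncoding_one _ _ _).trans ?_
    rw [h, hA.norm_sq, norm_one_apply_sq]
    by_cases hd : d.1 = j.2 <;> simp [hd, Finset.mem_product, -Finset.singleton_product,
      -Finset.product_singleton]

theorem tensorEncoding_gain_eq_right (h₁ : A₁ ∈ Matrix.unitaryGroup (Item m) ℂ)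
    (hA : IsHadamard (A₀ᴴ * A₁)) :
    (∀ j, gainAt (uniformPrior (Item m × Item m))
      (basisLik (A₁ᴴ ⊗ₖ A₁ᴴ) (tensorEncoding A₀ A₁)) j = m) ∧
    expectedGain (uniformPrior (Item m × Item m))
      (basisLik (A₁ᴴ ⊗ₖ A₁ᴴ) (tensorEncoding A₀ A₁)) = m := by
  have h : A₁ᴴ * A₁ = 1 := Matrix.mem_unitaryGroup_iff'.mp h₁
  have hA' : IsHadamard (A₁ᴴ * A₀) := by simpa using hA.conjTranspose
  rw [← half_logb_card_item_prod]
  -- Now `d₁` is read off, in the second register for `i = 0` and in the first for `i = 1`.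
  refine gain_eq_half_logb_card _ ![fun j => Finset.univ ×ˢ {j.2}, fun j => Finset.univ ×ˢ {j.1}]
    (fun i j d => ?_) (by simp)
  fin_cases i
  · refine (basisLik_tensorEncoding_zero _ _ _).trans ?_
    rw [h, hA'.norm_sq, norm_one_apply_sq]
    by_cases hd : d.2 = j.2 <;> simp [hd, Finset.mem_product, -Finset.singleton_product,
      -Finset.product_singleton]
  · refine (basisLik_tensorEncoding_one _ _ _).trans ?_
    rw [h, hA'.norm_sq, norm_one_apply_sq]
    by_cases hd : d.2 = j.1 <;> simp [hd, Finset.mem_product, -Finset.singleton_product,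
      -Finset.product_singleton]

/-- The `m`-fold tensor power of a matrix indexed by `Bool`. -/
def tensorPower (m : ℕ) (H : Matrix Bool Bool ℂ) : Matrix (Item m) (Item m) ℂ :=
  Matrix.of fun x y => ∏ i, H (x i) (y i)

theorem isHadamard_tensorPower (m : ℕ) {H : Matrix Bool Bool ℂ} (hH : IsHadamard H) :
    IsHadamard (tensorPower m H) := by
  refine ⟨?_, fun x y => ?_⟩
  · rw [Matrix.mem_unitaryGroup_iff, Matrix.star_eq_conjTranspose]
    ext x z
    have h : ∀ b c, ∑ e, H b e * star (H c e) = if b = c then 1 else 0 := by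
      intro b c
      have := congrFun₂ (Matrix.mem_unitaryGroup_iff.mp hH.1) b c
      simpa only [Matrix.star_eq_conjTranspose, Matrix.mul_apply, Matrix.conjTranspose_apply,
        Matrix.one_apply] using this
    calc (tensorPower m H * (tensorPower m H)ᴴ) x z
        = ∑ y : Item m, ∏ i, (H (x i) (y i) * star (H (z i) (y i))) := by
          simp [Matrix.mul_apply, tensorPower, Finset.prod_mul_distrib]
      _ = ∏ i, ∑ e, H (x i) e * star (H (z i) e) :=
          (Fintype.prod_sum fun i e => H (x i) e * star (H (z i) e)).symm
      _ = (1 : Matrix (Item m) (Item m) ℂ) x z := by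
          simp_rw [h, Finset.prod_ite_zero, Matrix.one_apply, funext_iff]
          simp
  · simp only [tensorPower, Matrix.of_apply, norm_prod, hH.2]
    rw [card_item, Finset.prod_const, Finset.card_univ, Fintype.card_fin, Fintype.card_bool,
      div_pow, one_pow, Nat.cast_pow, Real.sqrt_eq_rpow, Real.sqrt_eq_rpow,
      ← Real.rpow_mul_natCast (by positivity), ← Real.rpow_natCast_mul (by positivity), mul_comm]

theorem exists_isHadamard_bool : ∃ H : Matrix Bool Bool ℂ, IsHadamard H := by
  have hs : ((√2 : ℝ) : ℂ) * ((√2 : ℝ) : ℂ) = 2 := by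
    rw [← Complex.ofReal_mul, Real.mul_self_sqrt (by norm_num)]; norm_num
  refine ⟨Matrix.of fun a b => (if a && b then -1 else 1) / ((√2 : ℝ) : ℂ), ?_, ?_⟩
  · rw [Matrix.mem_unitaryGroup_iff, Matrix.star_eq_conjTranspose]
    ext a b
    cases a <;> cases b <;>
      simp only [Matrix.mul_apply, Matrix.one_apply, Matrix.conjTranspose_apply, Matrix.of_apply,
        Fintype.sum_bool, Complex.star_def, map_div₀, Complex.conj_ofReal, div_mul_div_comm, hs] <;>
      simp <;> norm_num
  · intro a b
    cases a <;> cases b <;> simp [abs_of_nonneg]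

end TwoItems

end PrivateQuery

theorem mainTheorem1 :
    -- general formulation
    (∀ (D : Type*) [Fintype D] [DecidableEq D] [Nonempty D] (E : Fin 2 → Matrix D D ℂ),
      (∀ i, E i ∈ Matrix.unitaryGroup D ℂ) → IsHadamard ((E 1)ᴴ * E 0) →
        -- measurement in an orthonormal basis
        (∀ M ∈ Matrix.unitaryGroup D ℂ,
          (∀ j, gainAt (uniformPrior D) (basisLik M E) j
            ≤ 1 / 2 * Real.logb 2 (Fintype.card D)) ∧
          expectedGain (uniformPrior D) (basisLik M E)
            ≤ 1 / 2 * Real.logb 2 (Fintype.card D)) ∧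
        -- projective measurement with projections of arbitrary rank
        (∀ (N : ℕ) (Q : ProjectiveMeasurement (Fin N) D),
          (∀ j, Q.proj j ≠ 0 → gainAt (uniformPrior D) (Q.lik E) j
            ≤ 1 / 2 * Real.logb 2 (Fintype.card D)) ∧
          expectedGain (uniformPrior D) (Q.lik E)
            ≤ 1 / 2 * Real.logb 2 (Fintype.card D)) ∧
        -- the bound is attained
        (∃ M ∈ Matrix.unitaryGroup D ℂ,
          (∀ j, gainAt (uniformPrior D) (basisLik M E) j
            = 1 / 2 * Real.logb 2 (Fintype.card D)) ∧
          expectedGain (uniformPrior D) (basisLik M E)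
            = 1 / 2 * Real.logb 2 (Fintype.card D))) ∧
    -- two items of `m` bits each
    (∀ m : ℕ,
      Fintype.card (Item m × Item m) = 2 ^ (2 * m) ∧
      (∃ A₀ ∈ Matrix.unitaryGroup (Item m) ℂ, ∃ A₁ ∈ Matrix.unitaryGroup (Item m) ℂ,
        IsHadamard (A₀ᴴ * A₁)) ∧
      ∀ A₀ ∈ Matrix.unitaryGroup (Item m) ℂ, ∀ A₁ ∈ Matrix.unitaryGroup (Item m) ℂ,
        IsHadamard (A₀ᴴ * A₁) →
          (∀ i, tensorEncoding A₀ A₁ i ∈ Matrix.unitaryGroup (Item m × Item m) ℂ) ∧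
          IsHadamard ((tensorEncoding A₀ A₁ 1)ᴴ * tensorEncoding A₀ A₁ 0) ∧
          (∀ M ∈ Matrix.unitaryGroup (Item m × Item m) ℂ,
            (∀ j, gainAt (uniformPrior (Item m × Item m))
              (basisLik M (tensorEncoding A₀ A₁)) j ≤ m) ∧
            expectedGain (uniformPrior (Item m × Item m))
              (basisLik M (tensorEncoding A₀ A₁)) ≤ m) ∧
          (∀ (N : ℕ) (Q : ProjectiveMeasurement (Fin N) (Item m × Item m)),
            (∀ j, Q.proj j ≠ 0 → gainAt (uniformPrior (Item m × Item m))
              (Q.lik (tensorEncoding A₀ A₁)) j ≤ m) ∧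
            expectedGain (uniformPrior (Item m × Item m))
              (Q.lik (tensorEncoding A₀ A₁)) ≤ m) ∧
          -- attained by the measurements that reveal the first, respectively the second item
          (∀ A, A = A₀ ∨ A = A₁ →
            (Aᴴ ⊗ₖ Aᴴ) ∈ Matrix.unitaryGroup (Item m × Item m) ℂ ∧
            (∀ j, gainAt (uniformPrior (Item m × Item m))
              (basisLik (Aᴴ ⊗ₖ Aᴴ) (tensorEncoding A₀ A₁)) j = m) ∧
            expectedGain (uniformPrior (Item m × Item m))
              (basisLik (Aᴴ ⊗ₖ Aᴴ) (tensorEncoding A₀ A₁)) = m)) := by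
  refine ⟨fun D _ _ _ E hE hH => ⟨fun M hM => basisLik_gain_le hE hH hM,
    fun N Q => Q.gain_le hE hH, exists_basisLik_gain_eq hE hH⟩, fun m => ⟨card_item_prod m, ?_, ?_⟩⟩
  · obtain ⟨H, hH⟩ := exists_isHadamard_bool
    have hW := isHadamard_tensorPower m hH
    -- With `A₀ = 1`, any Hadamard matrix serves as `A₁`.
    exact ⟨1, one_mem _, _, hW.1, by simpa using hW⟩
  · intro A₀ h₀ A₁ h₁ hA
    have hE := tensorEncoding_mem_unitaryGroup h₀ h₁
    have hH := isHadamard_tensorEncoding h₀ h₁ hA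
    refine ⟨hE, hH, fun M hM => ?_, fun N Q => ?_, ?_⟩
    · simpa only [half_logb_card_item_prod] using basisLik_gain_le hE hH hM
    · simpa only [half_logb_card_item_prod] using Q.gain_le hE hH
    · rintro A (rfl | rfl)
      · exact ⟨Matrix.kronecker_mem_unitary (conjTranspose_mem_unitaryGroup h₀)
          (conjTranspose_mem_unitaryGroup h₀), tensorEncoding_gain_eq_left h₀ hA⟩
      · exact ⟨Matrix.kronecker_mem_unitary (conjTranspose_mem_unitaryGroup h₁)
          (conjTranspose_mem_unitaryGroup h₁), tensorEncoding_gain_eq_right h₁ hA⟩
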